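/- Let $S$ and $V$ be finite-dimensional complex vector spaces with $\dim S=2$, and let $\mathrm{GL}(S)$ act on $$U=\mathrm{Hom}(S,V)\oplus\mathrm{Hom}(V,S)\oplus\mathrm{End}(S)$$ by $g\cdot(x,y,p)=(xg^{-1},\,gy,\,gpg^{-1})$. Let $\mathbb{C}[U]$ be the ring of polynomial functions on $U$, let $E_0=\operatorname{Spec}\mathbb{C}[U]^{\mathrm{GL}(S)}$ be the affine quotient, and let $\pi\colon U\to E_0$ be the quotient morphism. Then: 1. The morphism $$U\to \mathrm{End}(V)^{\oplus 2}\oplus\mathbb{C}^2,\qquad (x,y,p)\mapsto\big(xy,\ xpy,\ \det p,\ \mathrm{Tr}\,p\big),$$ is of the form $\iota\circ\pi$ for a closed immersion of schemes $\iota\colon E_0\to \mathrm{End}(V)^{\oplus 2}\oplus\mathbb{C}^2$. 2. For every basis of $V$, the ring $\mathbb{C}[U]^{\mathrm{GL}(S)}$ is generated as a $\mathbb{C}$-algebra by the matrix entries of $xy$ and $xpy$ together with $\det p$ and $\mathrm{Tr}\,p$. -/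

import Mathlib

open CategoryTheory AlgebraicGeometry

universe u

/-- The ring `ℂ[U]` of polynomial functions on a (finite-dimensional) complex vector space `U`:
the algebra of functions `U → ℂ` generated by the linear functionals. -/
def polyFun (U : Type u) [AddCommGroup U] [Module ℂ U] : Subalgebra ℂ (U → ℂ) :=
  Algebra.adjoin ℂ (Set.range fun φ : Module.Dual ℂ U => (φ : U → ℂ))

/-- The vector space `U` as an affine scheme, `Spec ℂ[U]`. -/
noncomputable def affineSpaceOf (U : Type u) [AddCommGroup U] [Module ℂ U] : Scheme.{u} :=
  Spec (CommRingCat.of (polyFun U))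

/-- A map of vector spaces is polynomial if every linear functional on the target pulls back to
a polynomial function. -/
def IsPolyMap {U W : Type u} [AddCommGroup U] [Module ℂ U] [AddCommGroup W] [Module ℂ W]
    (F : U → W) : Prop :=
  ∀ φ : Module.Dual ℂ W, (fun z => φ (F z)) ∈ polyFun U

theorem IsPolyMap.comp_mem {U W : Type u} [AddCommGroup U] [Module ℂ U] [AddCommGroup W]
    [Module ℂ W] {F : U → W} (hF : IsPolyMap F) {f : W → ℂ} (hf : f ∈ polyFun W) :
    (fun z => f (F z)) ∈ polyFun U := by
  unfold polyFun at hf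
  induction hf using Algebra.adjoin_induction with
  | mem f hf => obtain ⟨φ, rfl⟩ := hf; exact hF φ
  | algebraMap c => exact (polyFun U).algebraMap_mem c
  | add f g _ _ hf hg => exact (polyFun U).add_mem hf hg
  | mul f g _ _ hf hg => exact (polyFun U).mul_mem hf hg

/-- Pull-back of polynomial functions `f ↦ f ∘ F` along a polynomial map `F`. -/
def IsPolyMap.pullback {U W : Type u} [AddCommGroup U] [Module ℂ U] [AddCommGroup W]
    [Module ℂ W] {F : U → W} (hF : IsPolyMap F) : polyFun W →ₐ[ℂ] polyFun U where
  toFun f := ⟨fun z => f.1 (F z), hF.comp_mem f.2⟩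
  map_one' := rfl
  map_mul' _ _ := rfl
  map_zero' := rfl
  map_add' _ _ := rfl
  commutes' _ := rfl

/-- The morphism of affine schemes given by a polynomial map of vector spaces. -/
noncomputable def IsPolyMap.toHom {U W : Type u} [AddCommGroup U] [Module ℂ U]
    [AddCommGroup W] [Module ℂ W] {F : U → W} (hF : IsPolyMap F) :
    affineSpaceOf U ⟶ affineSpaceOf W :=
  Spec.map (CommRingCat.ofHom hF.pullback.toRingHom)

/-- The ring `ℂ[U]^G` of invariant polynomial functions of a representation. -/
def invariantRing {G : Type*} [Group G] {U : Type u} [AddCommGroup U] [Module ℂ U]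
    (ρ : Representation ℂ G U) : Subalgebra ℂ (U → ℂ) where
  carrier := {f | f ∈ polyFun U ∧ ∀ g z, f (ρ g z) = f z}
  mul_mem' := fun ⟨ha, ha'⟩ ⟨hb, hb'⟩ =>
    ⟨mul_mem ha hb, fun g z => by simp [ha' g z, hb' g z]⟩
  add_mem' := fun ⟨ha, ha'⟩ ⟨hb, hb'⟩ =>
    ⟨add_mem ha hb, fun g z => by simp [ha' g z, hb' g z]⟩
  algebraMap_mem' := fun c => ⟨(polyFun U).algebraMap_mem c, fun _ _ => rfl⟩

theorem invariantRing_le {G : Type*} [Group G] {U : Type u} [AddCommGroup U] [Module ℂ U]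
    (ρ : Representation ℂ G U) : invariantRing ρ ≤ polyFun U :=
  fun _ hf => hf.1

/-- The affine quotient `Spec ℂ[U]^G`. -/
noncomputable def affineQuotient {G : Type*} [Group G] {U : Type u} [AddCommGroup U]
    [Module ℂ U] (ρ : Representation ℂ G U) : Scheme.{u} :=
  Spec (CommRingCat.of (invariantRing ρ))

/-- The quotient morphism `U ⟶ Spec ℂ[U]^G`, given by the inclusion `ℂ[U]^G ⊆ ℂ[U]`. -/
noncomputable def quotientHom {G : Type*} [Group G] {U : Type u} [AddCommGroup U]
    [Module ℂ U] (ρ : Representation ℂ G U) : affineSpaceOf U ⟶ affineQuotient ρ :=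
  Spec.map (CommRingCat.ofHom (Subalgebra.inclusion (invariantRing_le ρ)).toRingHom)

/-- The vector space `Hom(S,V) ⊕ Hom(V,S) ⊕ End(S)`, with elements `(x, y, p)`. -/
abbrev HomHomEnd (S V : Type u) [AddCommGroup S] [Module ℂ S] [AddCommGroup V] [Module ℂ V] :
    Type u :=
  (S →ₗ[ℂ] V) × (V →ₗ[ℂ] S) × (S →ₗ[ℂ] S)

/-- The natural action of `GL(S)`: `g · (x, y, p) = (x g⁻¹, g y, g p g⁻¹)`. -/
def glRep (S V : Type u) [AddCommGroup S] [Module ℂ S] [AddCommGroup V] [Module ℂ V] :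
    Representation ℂ (LinearMap.GeneralLinearGroup ℂ S) (HomHomEnd S V) where
  toFun g :=
    { toFun := fun z =>
        (z.1 ∘ₗ (g⁻¹ : LinearMap.GeneralLinearGroup ℂ S).val,
          g.val ∘ₗ z.2.1,
          g.val ∘ₗ z.2.2 ∘ₗ (g⁻¹ : LinearMap.GeneralLinearGroup ℂ S).val)
      map_add' := fun z w => by
        simp [LinearMap.add_comp, LinearMap.comp_add]
      map_smul' := fun c z => by
        simp [LinearMap.smul_comp, LinearMap.comp_smul] }
  map_one' := by
    ext z <;> simp
  map_mul' g h := by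
    refine LinearMap.ext fun z => ?_
    refine Prod.ext ?_ (Prod.ext ?_ ?_) <;> ext s <;> simp [mul_inv_rev]

/-- The map `(x, y, p) ↦ (xy, xpy, det p, Tr p)`. -/
noncomputable def invariantMap (S V : Type u) [AddCommGroup S] [Module ℂ S] [AddCommGroup V]
    [Module ℂ V] (z : HomHomEnd S V) : (V →ₗ[ℂ] V) × (V →ₗ[ℂ] V) × ℂ × ℂ :=
  (z.1 ∘ₗ z.2.1, z.1 ∘ₗ z.2.2 ∘ₗ z.2.1, LinearMap.det z.2.2, LinearMap.trace ℂ S z.2.2)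

theorem linear_mem_polyFun {U : Type u} [AddCommGroup U] [Module ℂ U] (φ : Module.Dual ℂ U) :
    (fun z => φ z) ∈ polyFun U :=
  Algebra.subset_adjoin ⟨φ, rfl⟩

theorem comp_mem_polyFun {U A B C : Type u} [AddCommGroup U] [Module ℂ U] [AddCommGroup A]
    [Module ℂ A] [AddCommGroup B] [Module ℂ B] [AddCommGroup C] [Module ℂ C]
    [FiniteDimensional ℂ A] [FiniteDimensional ℂ B]
    {F : U → (B →ₗ[ℂ] C)} {H : U → (A →ₗ[ℂ] B)} (hF : IsPolyMap F) (hH : IsPolyMap H) :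
    IsPolyMap fun z => F z ∘ₗ H z := by
  intro φ
  let b := Module.finBasis ℂ (A →ₗ[ℂ] B)
  have key : (fun z => φ (F z ∘ₗ H z)) =
      ∑ i, (fun z => (b.coord i) (H z)) *
        fun z => (φ ∘ₗ (LinearMap.lcomp ℂ C (b i))) (F z) := by
    funext z
    have h := b.sum_repr (H z)
    conv_lhs => rw [← h]
    simp only [Finset.sum_apply, Pi.mul_apply]
    rw [show F z ∘ₗ (∑ i, b.repr (H z) i • b i) = ∑ i, b.repr (H z) i • (F z ∘ₗ b i) by
      refine LinearMap.ext fun a => ?_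
      simp only [LinearMap.comp_apply, LinearMap.sum_apply, LinearMap.smul_apply, map_sum,
        map_smul]]
    simp
    rfl
  rw [key]
  exact Subalgebra.sum_mem _ fun i _ => mul_mem (hH _) (hF _)

theorem isPolyMap_linear {U W : Type u} [AddCommGroup U] [Module ℂ U] [AddCommGroup W]
    [Module ℂ W] (L : U →ₗ[ℂ] W) : IsPolyMap fun z => L z :=
  fun φ => linear_mem_polyFun (φ ∘ₗ L)

theorem det_mem_polyFun {U S : Type u} [AddCommGroup U] [Module ℂ U] [AddCommGroup S]
    [Module ℂ S] [FiniteDimensional ℂ S] (L : U →ₗ[ℂ] (S →ₗ[ℂ] S)) :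
    (fun z => LinearMap.det (L z)) ∈ polyFun U := by
  let b := Module.finBasis ℂ S
  have key : (fun z => LinearMap.det (L z)) =
      ∑ σ : Equiv.Perm (Fin (Module.finrank ℂ S)), ((Equiv.Perm.sign σ : ℤ) : ℂ) •
        ∏ i, fun z => LinearMap.toMatrix b b (L z) (σ i) i := by
    funext z
    rw [← LinearMap.det_toMatrix b, Matrix.det_apply']
    simp
  rw [key]
  refine Subalgebra.sum_mem _ fun σ _ => Subalgebra.smul_mem _ (Subalgebra.prod_mem _
    fun i _ => ?_) _
  have h : (fun z => LinearMap.toMatrix b b (L z) (σ i) i) =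
      fun z => (b.coord (σ i) ∘ₗ (LinearMap.applyₗ (b i)) ∘ₗ L) z := by
    funext z
    simp [LinearMap.toMatrix_apply]
  rw [h]
  exact linear_mem_polyFun _

/-- The map `(x, y, p) ↦ (xy, xpy, det p, Tr p)` is polynomial. -/
theorem isPolyMap_invariantMap (S V : Type u) [AddCommGroup S] [Module ℂ S] [AddCommGroup V]
    [Module ℂ V] [FiniteDimensional ℂ S] [FiniteDimensional ℂ V] :
    IsPolyMap (invariantMap S V) := by
  intro φ
  have hx : IsPolyMap fun z : HomHomEnd S V => z.1 :=
    isPolyMap_linear (LinearMap.fst ℂ (S →ₗ[ℂ] V) ((V →ₗ[ℂ] S) × (S →ₗ[ℂ] S)))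
  have hy : IsPolyMap fun z : HomHomEnd S V => z.2.1 :=
    isPolyMap_linear (LinearMap.fst ℂ (V →ₗ[ℂ] S) (S →ₗ[ℂ] S) ∘ₗ
      LinearMap.snd ℂ (S →ₗ[ℂ] V) ((V →ₗ[ℂ] S) × (S →ₗ[ℂ] S)))
  have hp : IsPolyMap fun z : HomHomEnd S V => z.2.2 :=
    isPolyMap_linear (LinearMap.snd ℂ (V →ₗ[ℂ] S) (S →ₗ[ℂ] S) ∘ₗ
      LinearMap.snd ℂ (S →ₗ[ℂ] V) ((V →ₗ[ℂ] S) × (S →ₗ[ℂ] S)))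
  have h1 := comp_mem_polyFun hx hy
  have h2 := comp_mem_polyFun hx (comp_mem_polyFun hp hy)
  have h3 : (fun z : HomHomEnd S V => LinearMap.det z.2.2) ∈ polyFun (HomHomEnd S V) :=
    det_mem_polyFun (LinearMap.snd ℂ (V →ₗ[ℂ] S) (S →ₗ[ℂ] S) ∘ₗ
      LinearMap.snd ℂ (S →ₗ[ℂ] V) ((V →ₗ[ℂ] S) × (S →ₗ[ℂ] S)))
  have h4 := hp (LinearMap.trace ℂ S)
  have key : (fun z => φ (invariantMap S V z)) =
      (fun z => (φ ∘ₗ LinearMap.inl ℂ _ _) (z.1 ∘ₗ z.2.1)) +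
      (fun z => (φ ∘ₗ LinearMap.inr ℂ _ _ ∘ₗ LinearMap.inl ℂ _ _)
        (z.1 ∘ₗ z.2.2 ∘ₗ z.2.1)) +
      φ (0, 0, 1, 0) • (fun z : HomHomEnd S V => LinearMap.det z.2.2) +
      φ (0, 0, 0, 1) • (fun z : HomHomEnd S V => LinearMap.trace ℂ S z.2.2) := by
    funext z
    have hz : invariantMap S V z = (z.1 ∘ₗ z.2.1, 0, 0, 0) + (0, z.1 ∘ₗ z.2.2 ∘ₗ z.2.1, 0, 0)
        + LinearMap.det z.2.2 • (0, 0, 1, 0) + LinearMap.trace ℂ S z.2.2 • (0, 0, 0, 1) := by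
      simp [invariantMap]
    rw [hz, map_add, map_add, map_add, map_smul, map_smul]
    simp [mul_comm]
    rfl
  rw [key]
  exact add_mem (add_mem (add_mem (h1 _) (h2 _)) (Subalgebra.smul_mem _ h3 _))
    (Subalgebra.smul_mem _ h4 _)

/-!
Choose a basis of `S`, so that an invariant `f` becomes a polynomial in the entries of matrices
`x`, `y`, `p` with `f (x g⁻¹, g y, g p g⁻¹) = f (x, y, p)` for all invertible `2 × 2` matrices `g`.
The proof uses Cayley's Omega process instead of polarization and multilinear invariants.

For some `n`, the function `(det g) ^ n * f (x g⁻¹, g y, g p g⁻¹)` is a polynomial in `g`. It lies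
in the algebra `D` of covariants generated by `det g`, by the entries of `g v`, where `v` runs over
the columns of `y`, the rows of `x` (turned into columns by the symplectic form `[v, w] = v₀ w₁ -
v₁ w₀`) and their images under the traceless part `q` of `p`, by the entries of `g q adj g`, and by
the algebra `B` generated by the claimed invariants and the symplectic products of those vectors
(`MatrixTriple.exists_covariant`). The operator `Ω = ∂₀₀ ∂₁₁ - ∂₀₁ ∂₁₀` satisfies the Leibniz rule
up to a biderivation, and a table of its values on generators shows that it preserves `D`
(`GenericMatrix.IsOmegaStable.cayleyOmega_mem`). By invariance of `f`, the polynomial above is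
`(det g) ^ n * f`; since `Ω (det g) ^ (n + 1) = (n + 1) (n + 2) (det g) ^ n`, applying `Ω`
repeatedly and then setting `g = 0` gives `f ∈ B`
(`GenericMatrix.IsOmegaStable.mem_of_delta_pow_mul_mem`).

The generators of `B` that are not invariant under scalars `g = t` are the products `[v, w]` of two
rows and of two columns, of weights `-2` and `2`. As `f` has weight zero it is a combination of
products with as many of the former as of the latter, and the Plücker relation `[v, v'] [w, w'] =
[v, w] [v', w'] - [v, w'] [v', w]` rewrites these in terms of contractions of rows with columns,
which are entries of `x y` and `x p y` (`MatrixTriple.mem_traceAlgebra_of_scaling_invariant`). The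
closed immersion is the translation of this generation statement: the pull-back of polynomial
functions is surjective onto the invariants.
-/

/-! ### Cayley's Omega operator for `2 × 2` matrices -/

open MvPolynomial in
/-- Cayley's Omega operator `∂₀∂₃ - ∂₁∂₂` on polynomial functions of the `2 × 2` matrix
`!![X 0, X 1; X 2, X 3]`. -/
noncomputable def cayleyOmega : MvPolynomial (Fin 4) ℂ →ₗ[ℂ] MvPolynomial (Fin 4) ℂ :=
  (pderiv 0).toLinearMap ∘ₗ (pderiv 3).toLinearMap -
    (pderiv 1).toLinearMap ∘ₗ (pderiv 2).toLinearMap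

open MvPolynomial in
/-- The symmetric biderivation measuring the failure of the Leibniz rule for `cayleyOmega`. -/
noncomputable def omegaBracket (A B : MvPolynomial (Fin 4) ℂ) : MvPolynomial (Fin 4) ℂ :=
  pderiv 0 A * pderiv 3 B + pderiv 3 A * pderiv 0 B -
    pderiv 1 A * pderiv 2 B - pderiv 2 A * pderiv 1 B

theorem cayleyOmega_mul (A B : MvPolynomial (Fin 4) ℂ) :
    cayleyOmega (A * B) = cayleyOmega A * B + A * cayleyOmega B + omegaBracket A B := by
  simp only [cayleyOmega, omegaBracket, LinearMap.sub_apply, LinearMap.comp_apply,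
    Derivation.coeFn_coe, Derivation.leibniz, map_add, smul_eq_mul]
  ring

theorem omegaBracket_comm (A B : MvPolynomial (Fin 4) ℂ) :
    omegaBracket A B = omegaBracket B A := by
  simp only [omegaBracket]; ring

theorem omegaBracket_add_right (A B C : MvPolynomial (Fin 4) ℂ) :
    omegaBracket A (B + C) = omegaBracket A B + omegaBracket A C := by
  simp only [omegaBracket, map_add]; ring

theorem omegaBracket_mul_right (A B C : MvPolynomial (Fin 4) ℂ) :
    omegaBracket A (B * C) = omegaBracket A B * C + B * omegaBracket A C := by
  simp only [omegaBracket, Derivation.leibniz, smul_eq_mul]; ring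

open MvPolynomial in
theorem omegaBracket_C_right (A : MvPolynomial (Fin 4) ℂ) (c : ℂ) :
    omegaBracket A (C c) = 0 := by
  simp [omegaBracket]

open MvPolynomial in
theorem omegaBracket_C_left (c : ℂ) (A : MvPolynomial (Fin 4) ℂ) :
    omegaBracket (C c) A = 0 := by
  simp [omegaBracket]

open MvPolynomial in
theorem cayleyOmega_C (c : ℂ) : cayleyOmega (C c) = 0 := by
  simp [cayleyOmega]

namespace GenericMatrix
open MvPolynomial

/-- The first entry of `g v` for the generic matrix `g = !![X 0, X 1; X 2, X 3]`. -/
noncomputable def row₀ (v : Fin 2 → ℂ) : MvPolynomial (Fin 4) ℂ :=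
  C (v 0) * X 0 + C (v 1) * X 1

/-- The second entry of `g v` for the generic matrix `g`. -/
noncomputable def row₁ (v : Fin 2 → ℂ) : MvPolynomial (Fin 4) ℂ :=
  C (v 0) * X 2 + C (v 1) * X 3

/-- The determinant of the generic matrix. -/
noncomputable def delta : MvPolynomial (Fin 4) ℂ := X 0 * X 3 - X 1 * X 2

/-- For the generic matrix `g`, the entry `(0, 0)` of `g * q * adj g`, where `q` is the traceless
matrix `!![a, b; c, -a]`. The entry `(1, 1)` is its negative. -/
noncomputable def conj₀₀ (a b c : ℂ) : MvPolynomial (Fin 4) ℂ :=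
  (C a * X 0 + C c * X 1) * X 3 - (C b * X 0 - C a * X 1) * X 2

/-- The entry `(0, 1)` of `g * !![a, b; c, -a] * adj g`. -/
noncomputable def conj₀₁ (a b c : ℂ) : MvPolynomial (Fin 4) ℂ :=
  C b * X 0 ^ 2 - 2 * C a * X 0 * X 1 - C c * X 1 ^ 2

/-- The entry `(1, 0)` of `g * !![a, b; c, -a] * adj g`. -/
noncomputable def conj₁₀ (a b c : ℂ) : MvPolynomial (Fin 4) ℂ :=
  C c * X 3 ^ 2 + 2 * C a * X 2 * X 3 - C b * X 2 ^ 2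

/-- The traceless matrix `!![a, b; c, -a]` applied to `v`. -/
def traceless (a b c : ℂ) (v : Fin 2 → ℂ) : Fin 2 → ℂ := ![a * v 0 + b * v 1, c * v 0 - a * v 1]

/-- The symplectic form `v₀ w₁ - v₁ w₀` on `ℂ²`. -/
def symp (v w : Fin 2 → ℂ) : ℂ := v 0 * w 1 - v 1 * w 0

section brackets
variable (v w : Fin 2 → ℂ) (a b c : ℂ)

theorem pderiv_two (i : Fin 4) : pderiv i (2 : MvPolynomial (Fin 4) ℂ) = 0 := by
  rw [← map_ofNat (C : ℂ →+* MvPolynomial (Fin 4) ℂ) 2, pderiv_C]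

theorem pderiv_row₀ :
    pderiv 0 (row₀ v) = C (v 0) ∧
    pderiv 1 (row₀ v) = C (v 1) ∧
    pderiv 2 (row₀ v) = 0 ∧
    pderiv 3 (row₀ v) = 0 := by
  simp [row₀, pderiv_X]

theorem pderiv_row₁ :
    pderiv 0 (row₁ v) = 0 ∧
    pderiv 1 (row₁ v) = 0 ∧
    pderiv 2 (row₁ v) = C (v 0) ∧
    pderiv 3 (row₁ v) = C (v 1) := by
  simp [row₁, pderiv_X]

theorem pderiv_delta :
    pderiv 0 delta = X 3 ∧
    pderiv 1 delta = -X 2 ∧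
    pderiv 2 delta = -X 1 ∧
    pderiv 3 delta = X 0 := by
  simp [delta, pderiv_X]

theorem pderiv_conj₀₀ :
    pderiv 0 (conj₀₀ a b c) = C a * X 3 - C b * X 2 ∧
    pderiv 1 (conj₀₀ a b c) = C c * X 3 + C a * X 2 ∧
    pderiv 2 (conj₀₀ a b c) = C a * X 1 - C b * X 0 ∧
    pderiv 3 (conj₀₀ a b c) = C a * X 0 + C c * X 1 := by
  simp [conj₀₀, pderiv_X]
  constructor <;> ring

theorem pderiv_conj₀₁ :
    pderiv 0 (conj₀₁ a b c) = 2 * (C b * X 0 - C a * X 1) ∧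
    pderiv 1 (conj₀₁ a b c) = -2 * (C a * X 0 + C c * X 1) ∧
    pderiv 2 (conj₀₁ a b c) = 0 ∧
    pderiv 3 (conj₀₁ a b c) = 0 := by
  simp [conj₀₁, pderiv_two, pderiv_X]
  refine ⟨?_, ?_⟩ <;> ring

theorem pderiv_conj₁₀ :
    pderiv 0 (conj₁₀ a b c) = 0 ∧
    pderiv 1 (conj₁₀ a b c) = 0 ∧
    pderiv 2 (conj₁₀ a b c) = 2 * (C a * X 3 - C b * X 2) ∧
    pderiv 3 (conj₁₀ a b c) = 2 * (C a * X 2 + C c * X 3) := by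
  simp [conj₁₀, pderiv_two, pderiv_X]
  refine ⟨?_, ?_⟩ <;> ring

theorem omegaBracket_row₀_row₀ : omegaBracket (row₀ v) (row₀ w) = 0 := by
  simp only [omegaBracket, pderiv_row₀]
  ring

theorem omegaBracket_row₁_row₁ : omegaBracket (row₁ v) (row₁ w) = 0 := by
  simp only [omegaBracket, pderiv_row₁]
  ring

theorem omegaBracket_row₀_row₁ : omegaBracket (row₀ v) (row₁ w) = C (symp v w) := by
  simp only [omegaBracket, pderiv_row₀, pderiv_row₁]
  simp [symp]

theorem omegaBracket_row₀_conj₀₀ :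
    omegaBracket (row₀ v) (conj₀₀ a b c) = row₀ (traceless a b c v) := by
  simp only [omegaBracket, pderiv_conj₀₀, pderiv_row₀]
  simp [row₀, traceless]
  ring

theorem omegaBracket_row₁_conj₀₀ :
    omegaBracket (row₁ v) (conj₀₀ a b c) = -row₁ (traceless a b c v) := by
  simp only [omegaBracket, pderiv_conj₀₀, pderiv_row₁]
  simp [row₁, traceless]
  ring

theorem omegaBracket_row₀_conj₀₁ : omegaBracket (row₀ v) (conj₀₁ a b c) = 0 := by
  simp only [omegaBracket, pderiv_conj₀₁, pderiv_row₀]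
  ring

theorem omegaBracket_row₁_conj₁₀ : omegaBracket (row₁ v) (conj₁₀ a b c) = 0 := by
  simp only [omegaBracket, pderiv_conj₁₀, pderiv_row₁]
  ring

theorem omegaBracket_row₀_conj₁₀ :
    omegaBracket (row₀ v) (conj₁₀ a b c) = 2 * row₁ (traceless a b c v) := by
  simp only [omegaBracket, pderiv_conj₁₀, pderiv_row₀]
  simp [row₁, traceless]
  ring

theorem omegaBracket_row₁_conj₀₁ :
    omegaBracket (row₁ v) (conj₀₁ a b c) = 2 * row₀ (traceless a b c v) := by
  simp only [omegaBracket, pderiv_conj₀₁, pderiv_row₁]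
  simp [row₀, traceless]
  ring

theorem omegaBracket_conj₀₀_conj₀₀ :
    omegaBracket (conj₀₀ a b c) (conj₀₀ a b c) = 2 * C (a ^ 2 + b * c) * delta := by
  simp only [omegaBracket, pderiv_conj₀₀]
  simp only [delta, C_add, C_mul, C_pow]
  ring

theorem omegaBracket_conj₀₀_conj₀₁ : omegaBracket (conj₀₀ a b c) (conj₀₁ a b c) = 0 := by
  simp only [omegaBracket, pderiv_conj₀₀, pderiv_conj₀₁]
  ring

theorem omegaBracket_conj₀₀_conj₁₀ : omegaBracket (conj₀₀ a b c) (conj₁₀ a b c) = 0 := by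
  simp only [omegaBracket, pderiv_conj₀₀, pderiv_conj₁₀]
  ring

theorem omegaBracket_conj₀₁_conj₀₁ : omegaBracket (conj₀₁ a b c) (conj₀₁ a b c) = 0 := by
  simp only [omegaBracket, pderiv_conj₀₁]
  ring

theorem omegaBracket_conj₁₀_conj₁₀ : omegaBracket (conj₁₀ a b c) (conj₁₀ a b c) = 0 := by
  simp only [omegaBracket, pderiv_conj₁₀]
  ring

theorem omegaBracket_conj₀₁_conj₁₀ :
    omegaBracket (conj₀₁ a b c) (conj₁₀ a b c) = 4 * C (a ^ 2 + b * c) * delta := by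
  simp only [omegaBracket, pderiv_conj₀₁, pderiv_conj₁₀]
  simp only [delta, C_add, C_mul, C_pow]
  ring

theorem omegaBracket_row₀_delta : omegaBracket (row₀ v) delta = row₀ v := by
  simp only [omegaBracket, pderiv_delta, pderiv_row₀]
  simp only [row₀]
  ring

theorem omegaBracket_row₁_delta : omegaBracket (row₁ v) delta = row₁ v := by
  simp only [omegaBracket, pderiv_delta, pderiv_row₁]
  simp only [row₁]
  ring

theorem omegaBracket_delta_delta : omegaBracket delta delta = 2 * delta := by
  simp only [omegaBracket, pderiv_delta]
  simp only [delta]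
  ring

theorem omegaBracket_conj₀₀_delta : omegaBracket (conj₀₀ a b c) delta = 2 * conj₀₀ a b c := by
  simp only [omegaBracket, pderiv_conj₀₀, pderiv_delta]
  simp only [conj₀₀]
  ring

theorem omegaBracket_conj₀₁_delta : omegaBracket (conj₀₁ a b c) delta = 2 * conj₀₁ a b c := by
  simp only [omegaBracket, pderiv_conj₀₁, pderiv_delta]
  simp only [conj₀₁]
  ring

theorem omegaBracket_conj₁₀_delta : omegaBracket (conj₁₀ a b c) delta = 2 * conj₁₀ a b c := by
  simp only [omegaBracket, pderiv_conj₁₀, pderiv_delta]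
  simp only [conj₁₀]
  ring

theorem cayleyOmega_row₀ : cayleyOmega (row₀ v) = 0 := by
  simp [cayleyOmega, pderiv_row₀]

theorem cayleyOmega_row₁ : cayleyOmega (row₁ v) = 0 := by
  simp [cayleyOmega, pderiv_row₁]

theorem cayleyOmega_delta : cayleyOmega delta = 2 := by
  simp [cayleyOmega, pderiv_delta, pderiv_X]
  ring

theorem cayleyOmega_conj₀₀ : cayleyOmega (conj₀₀ a b c) = 0 := by
  simp [cayleyOmega, pderiv_conj₀₀, pderiv_X]

theorem cayleyOmega_conj₀₁ : cayleyOmega (conj₀₁ a b c) = 0 := by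
  simp [cayleyOmega, pderiv_conj₀₁]

theorem cayleyOmega_conj₁₀ : cayleyOmega (conj₁₀ a b c) = 0 := by
  simp [cayleyOmega, pderiv_conj₁₀, pderiv_two, pderiv_X]

end brackets
end GenericMatrix

/-! ### Covariants and their stability under the Omega operator -/

namespace GenericMatrix
open MvPolynomial

/-- Generators of the algebra of covariants: families, indexed by `U`, of polynomials in a generic
matrix `g`. They are the constants from `B`, the entries of `g v` for `v ∈ 𝒱`, the determinant of
`g`, and the entries of `g q adj(g)` for the traceless matrix `q = !![a, b; c, -a]`. -/
inductive IsCovariantGenerator {U : Type*} (B : Subalgebra ℂ (U → ℂ)) (𝒱 : Set (U → Fin 2 → ℂ))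
    (a b c : U → ℂ) : (U → MvPolynomial (Fin 4) ℂ) → Prop
  | const (β : U → ℂ) (hβ : β ∈ B) : IsCovariantGenerator B 𝒱 a b c fun u => C (β u)
  | row₀ (v : U → Fin 2 → ℂ) (hv : v ∈ 𝒱) : IsCovariantGenerator B 𝒱 a b c fun u => row₀ (v u)
  | row₁ (v : U → Fin 2 → ℂ) (hv : v ∈ 𝒱) : IsCovariantGenerator B 𝒱 a b c fun u => row₁ (v u)
  | delta : IsCovariantGenerator B 𝒱 a b c fun _ => delta
  | conj₀₀ : IsCovariantGenerator B 𝒱 a b c fun u => conj₀₀ (a u) (b u) (c u)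
  | conj₀₁ : IsCovariantGenerator B 𝒱 a b c fun u => conj₀₁ (a u) (b u) (c u)
  | conj₁₀ : IsCovariantGenerator B 𝒱 a b c fun u => conj₁₀ (a u) (b u) (c u)

/-- The algebra generated by the covariants of `IsCovariantGenerator`. -/
noncomputable def covariantAlgebra {U : Type*} (B : Subalgebra ℂ (U → ℂ)) (𝒱 : Set (U → Fin 2 → ℂ))
    (a b c : U → ℂ) : Subalgebra ℂ (U → MvPolynomial (Fin 4) ℂ) :=
  Algebra.adjoin ℂ {E | IsCovariantGenerator B 𝒱 a b c E}

theorem IsCovariantGenerator.mem {U : Type*} {B : Subalgebra ℂ (U → ℂ)}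
    {𝒱 : Set (U → Fin 2 → ℂ)} {a b c : U → ℂ} {E : U → MvPolynomial (Fin 4) ℂ}
    (h : IsCovariantGenerator B 𝒱 a b c E) : E ∈ covariantAlgebra B 𝒱 a b c :=
  Algebra.subset_adjoin h

/-- The conditions under which the algebra of covariants is stable under Cayley's operator: `B`
contains `a ^ 2 + b * c = -det q` and the symplectic products of members of `𝒱`, and `q` maps `𝒱`
into multiples of `𝒱` by elements of `B`. -/
structure IsOmegaStable {U : Type*} (B : Subalgebra ℂ (U → ℂ)) (𝒱 : Set (U → Fin 2 → ℂ))
    (a b c : U → ℂ) : Prop where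
  det_mem : (fun u => a u ^ 2 + b u * c u) ∈ B
  symp_mem : ∀ v ∈ 𝒱, ∀ w ∈ 𝒱, (fun u => symp (v u) (w u)) ∈ B
  traceless_mem : ∀ v ∈ 𝒱, ∃ β ∈ B, ∃ w ∈ 𝒱, ∀ u, traceless (a u) (b u) (c u) (v u) = β u • w u

section stable
variable {U : Type*} {B : Subalgebra ℂ (U → ℂ)} {𝒱 : Set (U → Fin 2 → ℂ)} {a b c : U → ℂ}

theorem IsOmegaStable.row₀_traceless_mem (h : IsOmegaStable B 𝒱 a b c) {v : U → Fin 2 → ℂ}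
    (hv : v ∈ 𝒱) :
    (fun u => row₀ (traceless (a u) (b u) (c u) (v u))) ∈ covariantAlgebra B 𝒱 a b c := by
  obtain ⟨β, hβ, w, hw, e⟩ := h.traceless_mem v hv
  convert mul_mem (IsCovariantGenerator.const (𝒱 := 𝒱) (a := a) (b := b) (c := c) β hβ).mem
    (IsCovariantGenerator.row₀ w hw).mem using 1
  funext u
  simp [e, row₀]
  ring

theorem IsOmegaStable.row₁_traceless_mem (h : IsOmegaStable B 𝒱 a b c) {v : U → Fin 2 → ℂ}
    (hv : v ∈ 𝒱) :
    (fun u => row₁ (traceless (a u) (b u) (c u) (v u))) ∈ covariantAlgebra B 𝒱 a b c := by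
  obtain ⟨β, hβ, w, hw, e⟩ := h.traceless_mem v hv
  convert mul_mem (IsCovariantGenerator.const (𝒱 := 𝒱) (a := a) (b := b) (c := c) β hβ).mem
    (IsCovariantGenerator.row₁ w hw).mem using 1
  funext u
  simp [e, row₁]
  ring

theorem ofNat_mul_mem_covariantAlgebra (n : ℕ) [n.AtLeastTwo] {E : U → MvPolynomial (Fin 4) ℂ}
    (hE : E ∈ covariantAlgebra B 𝒱 a b c) :
    (fun u => (OfNat.ofNat n : MvPolynomial (Fin 4) ℂ) * E u) ∈ covariantAlgebra B 𝒱 a b c :=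
  mul_mem (ofNat_mem _ n) hE

theorem IsOmegaStable.omegaBracket_generator_mem (h : IsOmegaStable B 𝒱 a b c)
    {E F : U → MvPolynomial (Fin 4) ℂ} (hE : IsCovariantGenerator B 𝒱 a b c E)
    (hF : IsCovariantGenerator B 𝒱 a b c F) :
    (fun u => omegaBracket (E u) (F u)) ∈ covariantAlgebra B 𝒱 a b c := by
  have hdet : (fun u => 2 * C (a u ^ 2 + b u * c u) * delta) ∈ covariantAlgebra B 𝒱 a b c :=
    mul_mem (ofNat_mul_mem_covariantAlgebra 2 (IsCovariantGenerator.const _ h.det_mem).mem)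
      IsCovariantGenerator.delta.mem
  have hdet' : (fun u => 4 * C (a u ^ 2 + b u * c u) * delta) ∈ covariantAlgebra B 𝒱 a b c :=
    mul_mem (ofNat_mul_mem_covariantAlgebra 4 (IsCovariantGenerator.const _ h.det_mem).mem)
      IsCovariantGenerator.delta.mem
  have hzero : (fun _ => 0) ∈ covariantAlgebra B 𝒱 a b c := zero_mem _
  have hdelta : (fun _ => 2 * delta) ∈ covariantAlgebra B 𝒱 a b c :=
    ofNat_mul_mem_covariantAlgebra 2 IsCovariantGenerator.delta.mem
  have h₀₀ : (fun u => 2 * conj₀₀ (a u) (b u) (c u)) ∈ covariantAlgebra B 𝒱 a b c :=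
    ofNat_mul_mem_covariantAlgebra 2 IsCovariantGenerator.conj₀₀.mem
  have h₀₁ : (fun u => 2 * conj₀₁ (a u) (b u) (c u)) ∈ covariantAlgebra B 𝒱 a b c :=
    ofNat_mul_mem_covariantAlgebra 2 IsCovariantGenerator.conj₀₁.mem
  have h₁₀ : (fun u => 2 * conj₁₀ (a u) (b u) (c u)) ∈ covariantAlgebra B 𝒱 a b c :=
    ofNat_mul_mem_covariantAlgebra 2 IsCovariantGenerator.conj₁₀.mem
  have hr₀ : ∀ v ∈ 𝒱, (fun u => row₀ (v u)) ∈ covariantAlgebra B 𝒱 a b c :=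
    fun v hv => (IsCovariantGenerator.row₀ v hv).mem
  have hr₁ : ∀ v ∈ 𝒱, (fun u => row₁ (v u)) ∈ covariantAlgebra B 𝒱 a b c :=
    fun v hv => (IsCovariantGenerator.row₁ v hv).mem
  have hs : ∀ v ∈ 𝒱, ∀ w ∈ 𝒱, (fun u => C (symp (v u) (w u))) ∈ covariantAlgebra B 𝒱 a b c :=
    fun v hv w hw => (IsCovariantGenerator.const _ (h.symp_mem v hv w hw)).mem
  have ht₀ : ∀ v ∈ 𝒱, (fun u => row₀ (traceless (a u) (b u) (c u) (v u))) ∈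
      covariantAlgebra B 𝒱 a b c :=
    fun v hv => h.row₀_traceless_mem hv
  have ht₁ : ∀ v ∈ 𝒱, (fun u => -row₁ (traceless (a u) (b u) (c u) (v u))) ∈
      covariantAlgebra B 𝒱 a b c :=
    fun v hv => neg_mem (h.row₁_traceless_mem hv)
  have ht₀' : ∀ v ∈ 𝒱, (fun u => 2 * row₀ (traceless (a u) (b u) (c u) (v u))) ∈
      covariantAlgebra B 𝒱 a b c :=
    fun v hv => ofNat_mul_mem_covariantAlgebra 2 (h.row₀_traceless_mem hv)
  have ht₁' : ∀ v ∈ 𝒱, (fun u => 2 * row₁ (traceless (a u) (b u) (c u) (v u))) ∈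
      covariantAlgebra B 𝒱 a b c :=
    fun v hv => ofNat_mul_mem_covariantAlgebra 2 (h.row₁_traceless_mem hv)
  cases hE <;> cases hF
  -- The table of brackets lists each unordered pair of generators once.
  all_goals simp only [omegaBracket_C_left, omegaBracket_C_right,
    omegaBracket_comm (row₁ _) (row₀ _), omegaBracket_comm (conj₀₀ _ _ _) (row₀ _),
    omegaBracket_comm (conj₀₀ _ _ _) (row₁ _), omegaBracket_comm (conj₀₁ _ _ _) (row₀ _),
    omegaBracket_comm (conj₀₁ _ _ _) (row₁ _), omegaBracket_comm (conj₁₀ _ _ _) (row₀ _),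
    omegaBracket_comm (conj₁₀ _ _ _) (row₁ _), omegaBracket_comm (conj₀₁ _ _ _) (conj₀₀ _ _ _),
    omegaBracket_comm (conj₁₀ _ _ _) (conj₀₀ _ _ _),
    omegaBracket_comm (conj₁₀ _ _ _) (conj₀₁ _ _ _), omegaBracket_comm delta (row₀ _),
    omegaBracket_comm delta (row₁ _), omegaBracket_comm delta (conj₀₀ _ _ _),
    omegaBracket_comm delta (conj₀₁ _ _ _), omegaBracket_comm delta (conj₁₀ _ _ _),
    omegaBracket_row₀_row₀, omegaBracket_row₁_row₁,
    omegaBracket_row₀_row₁, omegaBracket_row₀_conj₀₀, omegaBracket_row₁_conj₀₀,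
    omegaBracket_row₀_conj₀₁, omegaBracket_row₁_conj₁₀, omegaBracket_row₀_conj₁₀,
    omegaBracket_row₁_conj₀₁, omegaBracket_conj₀₀_conj₀₀, omegaBracket_conj₀₀_conj₀₁,
    omegaBracket_conj₀₀_conj₁₀, omegaBracket_conj₀₁_conj₀₁, omegaBracket_conj₁₀_conj₁₀,
    omegaBracket_conj₀₁_conj₁₀, omegaBracket_row₀_delta, omegaBracket_row₁_delta,
    omegaBracket_delta_delta, omegaBracket_conj₀₀_delta, omegaBracket_conj₀₁_delta,
    omegaBracket_conj₁₀_delta]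
  all_goals with_reducible first
    | assumption
    | exact hr₀ _ ‹_›
    | exact hr₁ _ ‹_›
    | exact hs _ ‹_› _ ‹_›
    | exact ht₀ _ ‹_›
    | exact ht₁ _ ‹_›
    | exact ht₀' _ ‹_›
    | exact ht₁' _ ‹_›

/-- The bracket is the correction term in `cayleyOmega_mul`, so this stability is what makes the
algebra of covariants stable under Cayley's operator. -/
theorem IsOmegaStable.omegaBracket_mem (h : IsOmegaStable B 𝒱 a b c)
    {E F : U → MvPolynomial (Fin 4) ℂ} (hE : E ∈ covariantAlgebra B 𝒱 a b c)
    (hF : F ∈ covariantAlgebra B 𝒱 a b c) :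
    (fun u => omegaBracket (E u) (F u)) ∈ covariantAlgebra B 𝒱 a b c := by
  -- A biderivation is controlled by its values on generators, one argument at a time.
  have extend : ∀ E : U → MvPolynomial (Fin 4) ℂ,
      (∀ F, IsCovariantGenerator B 𝒱 a b c F →
        (fun u => omegaBracket (E u) (F u)) ∈ covariantAlgebra B 𝒱 a b c) →
      ∀ F ∈ covariantAlgebra B 𝒱 a b c,
        (fun u => omegaBracket (E u) (F u)) ∈ covariantAlgebra B 𝒱 a b c := by
    intro E hgen F hF
    unfold covariantAlgebra at hF
    induction hF using Algebra.adjoin_induction with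
    | mem F hF => exact hgen F hF
    | algebraMap k =>
      simp only [Pi.algebraMap_apply, algebraMap_eq, omegaBracket_C_right]
      exact zero_mem _
    | add F G _ _ hF hG =>
      simp only [Pi.add_apply, omegaBracket_add_right]
      exact add_mem hF hG
    | mul F G hF' hG' hF hG =>
      simp only [Pi.mul_apply, omegaBracket_mul_right]
      exact add_mem (mul_mem hF hG') (mul_mem hF' hG)
  refine extend E (fun F hF => ?_) F hF
  simp only [omegaBracket_comm _ (F _)]
  exact extend F (fun G hG => h.omegaBracket_generator_mem hF hG) E hE

theorem IsOmegaStable.cayleyOmega_mem (h : IsOmegaStable B 𝒱 a b c)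
    {E : U → MvPolynomial (Fin 4) ℂ} (hE : E ∈ covariantAlgebra B 𝒱 a b c) :
    (fun u => cayleyOmega (E u)) ∈ covariantAlgebra B 𝒱 a b c := by
  have hE' := hE
  unfold covariantAlgebra at hE'
  induction hE' using Algebra.adjoin_induction with
  | mem E hE =>
    have hzero : (fun _ => 0) ∈ covariantAlgebra B 𝒱 a b c := zero_mem _
    have htwo : (fun _ => 2) ∈ covariantAlgebra B 𝒱 a b c := ofNat_mem _ 2
    have hgen : IsCovariantGenerator B 𝒱 a b c E := by assumption
    cases hgen <;> simpa only [cayleyOmega_C, cayleyOmega_row₀, cayleyOmega_row₁,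
      cayleyOmega_delta, cayleyOmega_conj₀₀, cayleyOmega_conj₀₁, cayleyOmega_conj₁₀]
  | algebraMap k =>
    simp only [Pi.algebraMap_apply, algebraMap_eq, cayleyOmega_C]
    exact zero_mem _
  | add F G hF' hG' hF hG =>
    simp only [Pi.add_apply, map_add]
    exact add_mem (hF hF') (hG hG')
  | mul F G hF' hG' hF hG =>
    simp only [Pi.mul_apply, cayleyOmega_mul]
    exact add_mem (add_mem (mul_mem (hF hF') hG') (mul_mem hF' (hG hG')))
      (h.omegaBracket_mem hF' hG')

theorem C_two : (C 2 : MvPolynomial (Fin 4) ℂ) = 2 := map_ofNat C 2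

theorem omegaBracket_delta_pow (n : ℕ) :
    omegaBracket delta (delta ^ n) = C (2 * n : ℂ) * delta ^ n := by
  induction n with
  | zero => simp [omegaBracket]
  | succ n ih =>
    rw [pow_succ, omegaBracket_mul_right, ih, omegaBracket_delta_delta]
    simp [C_two]
    ring

/-- Cayley's identity for `2 × 2` matrices. -/
theorem cayleyOmega_delta_pow_succ (n : ℕ) :
    cayleyOmega (delta ^ (n + 1)) = C ((n + 1) * (n + 2) : ℂ) * delta ^ n := by
  induction n with
  | zero => simp [cayleyOmega_delta, C_two]
  | succ n ih =>
    rw [pow_succ', cayleyOmega_mul, ih, omegaBracket_delta_pow, cayleyOmega_delta]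
    simp [C_two]
    ring

/-- The constant term at `g = 0` of a covariant lies in the ring of coefficients. -/
theorem constantCoeff_mem {E : U → MvPolynomial (Fin 4) ℂ}
    (hE : E ∈ covariantAlgebra B 𝒱 a b c) : (fun u => constantCoeff (E u)) ∈ B := by
  unfold covariantAlgebra at hE
  induction hE using Algebra.adjoin_induction with
  | mem E hE =>
    have hzero : (fun _ => 0) ∈ B := zero_mem _
    cases hE with
    | const β hβ => simpa using hβ
    | _ => simpa [row₀, row₁, delta, conj₀₀, conj₀₁, conj₁₀]
  | algebraMap k => 
    simp only [Pi.algebraMap_apply, algebraMap_eq, constantCoeff_C]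
    exact B.algebraMap_mem k
  | add F G _ _ hF hG =>
    simp only [Pi.add_apply, map_add]
    exact add_mem hF hG
  | mul F G _ _ hF hG =>
    simp only [Pi.mul_apply, map_mul]
    exact mul_mem hF hG

/-- Applying Cayley's operator `n` times removes the factor `delta ^ n`. -/
theorem IsOmegaStable.mem_of_delta_pow_mul_mem (h : IsOmegaStable B 𝒱 a b c) (n : ℕ)
    {f : U → ℂ} (hf : (fun u => C (f u) * delta ^ n) ∈ covariantAlgebra B 𝒱 a b c) : f ∈ B := by
  induction n with
  | zero => simpa using constantCoeff_mem hf
  | succ n ih =>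
    apply ih
    have hne : ((n + 1) * (n + 2) : ℂ) ≠ 0 := by norm_cast
    have key := Subalgebra.smul_mem _ (h.cayleyOmega_mem hf) ((n + 1) * (n + 2) : ℂ)⁻¹
    convert key using 1
    funext u
    rw [Pi.smul_apply, ← smul_eq_C_mul, ← smul_eq_C_mul, map_smul,
      cayleyOmega_delta_pow_succ, ← smul_eq_C_mul,
      smul_comm, inv_smul_smul₀ hne]

end stable
end GenericMatrix

/-! ### Matrix invariants of a triple `(x, y, p)` -/

namespace MatrixTriple
open GenericMatrix

section
variable {U I J : Type*} (x : U → Matrix I (Fin 2) ℂ) (y : U → Matrix (Fin 2) J ℂ)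
  (p : U → Matrix (Fin 2) (Fin 2) ℂ)

/-- The algebra generated by the entries of `x y` and `x p y` together with `det p` and `tr p`. -/
noncomputable def traceAlgebra : Subalgebra ℂ (U → ℂ) :=
  Algebra.adjoin ℂ
    ((Set.range fun ij : I × J => fun u => (x u * y u) ij.1 ij.2) ∪
      (Set.range fun ij : I × J => fun u => (x u * p u * y u) ij.1 ij.2) ∪
      {fun u => (p u).det, fun u => (p u).trace})

/-- The algebra generated by the matrix entries of `x`, `y` and `p`. -/
noncomputable def entryAlgebra : Subalgebra ℂ (U → ℂ) :=
  Algebra.adjoin ℂ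
    ((Set.range fun ik : I × Fin 2 => fun u => x u ik.1 ik.2) ∪
      (Set.range fun kj : Fin 2 × J => fun u => y u kj.1 kj.2) ∪
      (Set.range fun kl : Fin 2 × Fin 2 => fun u => p u kl.1 kl.2))

/-- The triple at `u'` is the transform `(x M⁻¹, M y, M p M⁻¹)` of the triple at `u`, with
denominators cleared. -/
structure IsTransform (M : Matrix (Fin 2) (Fin 2) ℂ) (u u' : U) : Prop where
  left : x u' * M = x u
  right : y u' = M * y u
  conj : p u' * M = M * p u

/-- The traceless part of `p` acting on `ℂ²`. -/
noncomputable def tracelessPart (u : U) : (Fin 2 → ℂ) → Fin 2 → ℂ :=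
  traceless ((p u 0 0 - p u 1 1) / 2) (p u 0 1) (p u 1 0)

/-- The rows of `x`, turned into vectors by the symplectic form. -/
def leftVec (i : I) (u : U) : Fin 2 → ℂ := ![-x u i 1, x u i 0]

/-- The columns of `y`. -/
def rightVec (j : J) (u : U) : Fin 2 → ℂ := fun k => y u k j

/-- The vectors from the rows of `x` and their images under the traceless part of `p`. -/
def leftVecs : Set (U → Fin 2 → ℂ) :=
  Set.range (leftVec x) ∪ Set.range fun i u => tracelessPart p u (leftVec x i u)

/-- The columns of `y` and their images under the traceless part of `p`. -/
def rightVecs : Set (U → Fin 2 → ℂ) :=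
  Set.range (rightVec y) ∪ Set.range fun j u => tracelessPart p u (rightVec y j u)

/-- The symplectic products of pairs of vectors from `𝒱`. -/
def sympProducts (𝒱 : Set (U → Fin 2 → ℂ)) : Set (U → ℂ) :=
  {f | ∃ v ∈ 𝒱, ∃ w ∈ 𝒱, f = fun u => symp (v u) (w u)}

/-- The algebra generated by `traceAlgebra` together with the symplectic products of pairs from
`leftVecs` and of pairs from `rightVecs`. Its elements are invariant under `SL₂`, but not all
of them under scalars. -/
noncomputable def symplecticAlgebra : Subalgebra ℂ (U → ℂ) :=
  Algebra.adjoin ℂ ((traceAlgebra x y p : Set (U → ℂ)) ∪ sympProducts (leftVecs x p) ∪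
    sympProducts (rightVecs y p))

theorem mul_mem_traceAlgebra (i : I) (j : J) :
    (fun u => x u i 0 * y u 0 j + x u i 1 * y u 1 j) ∈ traceAlgebra x y p := by
  refine Algebra.subset_adjoin (Or.inl (Or.inl ⟨(i, j), ?_⟩))
  funext u
  simp [Matrix.mul_apply]

theorem mul_mul_mem_traceAlgebra (i : I) (j : J) :
    (fun u => (x u i 0 * p u 0 0 + x u i 1 * p u 1 0) * y u 0 j +
      (x u i 0 * p u 0 1 + x u i 1 * p u 1 1) * y u 1 j) ∈ traceAlgebra x y p := by
  refine Algebra.subset_adjoin (Or.inl (Or.inr ⟨(i, j), ?_⟩))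
  funext u
  simp [Matrix.mul_apply]

theorem det_mem_traceAlgebra : (fun u => (p u).det) ∈ traceAlgebra x y p :=
  Algebra.subset_adjoin (Or.inr (Or.inl rfl))

theorem trace_mem_traceAlgebra : (fun u => (p u).trace) ∈ traceAlgebra x y p :=
  Algebra.subset_adjoin (Or.inr (Or.inr rfl))

theorem tracelessDet_mem_traceAlgebra :
    (fun u => ((p u 0 0 - p u 1 1) / 2) ^ 2 + p u 0 1 * p u 1 0) ∈ traceAlgebra x y p := by
  convert sub_mem (Subalgebra.smul_mem _ (pow_mem (trace_mem_traceAlgebra x y p) 2) (1 / 4 : ℂ))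
    (det_mem_traceAlgebra x y p) using 1
  funext u
  simp [Matrix.trace_fin_two, Matrix.det_fin_two]
  ring

theorem symp_leftVec_mem (i : I) (j : J) :
    (fun u => symp (leftVec x i u) (rightVec y j u)) ∈ traceAlgebra x y p := by
  convert neg_mem (mul_mem_traceAlgebra x y p i j) using 1
  funext u
  simp [symp, leftVec, rightVec]
  ring

theorem symp_leftVec_traceless_mem (i : I) (j : J) :
    (fun u => symp (leftVec x i u) (tracelessPart p u (rightVec y j u))) ∈
      traceAlgebra x y p := by
  convert sub_mem (Subalgebra.smul_mem _ (mul_mem (trace_mem_traceAlgebra x y p)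
    (mul_mem_traceAlgebra x y p i j)) (1 / 2 : ℂ)) (mul_mul_mem_traceAlgebra x y p i j) using 1
  funext u
  simp [symp, leftVec, rightVec, tracelessPart, traceless, Matrix.trace_fin_two]
  ring

theorem symp_left_right_mem {v w : U → Fin 2 → ℂ} (hv : v ∈ leftVecs x p)
    (hw : w ∈ rightVecs y p) : (fun u => symp (v u) (w u)) ∈ traceAlgebra x y p := by
  rcases hv with ⟨i, rfl⟩ | ⟨i, rfl⟩ <;> rcases hw with ⟨j, rfl⟩ | ⟨j, rfl⟩
  · exact symp_leftVec_mem x y p i j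
  · exact symp_leftVec_traceless_mem x y p i j
  · -- Traceless matrices are skew for the symplectic form.
    convert neg_mem (symp_leftVec_traceless_mem x y p i j) using 1
    funext u
    simp [symp, tracelessPart, traceless]
    ring
  · convert neg_mem (mul_mem (tracelessDet_mem_traceAlgebra x y p) (symp_leftVec_mem x y p i j))
      using 1
    funext u
    simp [symp, tracelessPart, traceless]
    ring

/-- By the Plücker relation, a product of a bracket of rows and a bracket of columns is a
polynomial in contractions of rows with columns. -/
theorem sympProducts_mul_mem {f g : U → ℂ} (hf : f ∈ sympProducts (leftVecs x p))
    (hg : g ∈ sympProducts (rightVecs y p)) : f * g ∈ traceAlgebra x y p := by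
  obtain ⟨v, hv, v', hv', rfl⟩ := hf
  obtain ⟨w, hw, w', hw', rfl⟩ := hg
  have h := fun {v w} hv hw => symp_left_right_mem x y p (v := v) (w := w) hv hw
  convert sub_mem (mul_mem (h hv hw) (h hv' hw')) (mul_mem (h hv hw') (h hv' hw)) using 1
  funext u
  simp [symp]
  ring

/-- The Cayley-Hamilton theorem for the traceless part of `p`. -/
theorem tracelessPart_tracelessPart (u : U) (v : Fin 2 → ℂ) :
    tracelessPart p u (tracelessPart p u v) =
      (((p u 0 0 - p u 1 1) / 2) ^ 2 + p u 0 1 * p u 1 0) • v := by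
  funext k
  fin_cases k <;> simp [tracelessPart, traceless] <;> ring

theorem traceAlgebra_le_symplecticAlgebra : traceAlgebra x y p ≤ symplecticAlgebra x y p :=
  fun _ hf => Algebra.subset_adjoin (Or.inl (Or.inl hf))

theorem isOmegaStable_symplecticAlgebra :
    IsOmegaStable (symplecticAlgebra x y p) (leftVecs x p ∪ rightVecs y p)
      (fun u => (p u 0 0 - p u 1 1) / 2) (fun u => p u 0 1) (fun u => p u 1 0) where
  det_mem := traceAlgebra_le_symplecticAlgebra x y p (tracelessDet_mem_traceAlgebra x y p)
  symp_mem := by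
    rintro v (hv | hv) w (hw | hw)
    · exact Algebra.subset_adjoin (Or.inl (Or.inr ⟨v, hv, w, hw, rfl⟩))
    · exact traceAlgebra_le_symplecticAlgebra x y p (symp_left_right_mem x y p hv hw)
    · convert neg_mem (traceAlgebra_le_symplecticAlgebra x y p
        (symp_left_right_mem x y p hw hv)) using 1
      funext u
      simp [symp]
      ring
    · exact Algebra.subset_adjoin (Or.inr ⟨v, hv, w, hw, rfl⟩)
  traceless_mem := by
    have hdet := traceAlgebra_le_symplecticAlgebra x y p (tracelessDet_mem_traceAlgebra x y p)
    rintro v ((⟨i, rfl⟩ | ⟨i, rfl⟩) | (⟨j, rfl⟩ | ⟨j, rfl⟩))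
    · exact ⟨1, one_mem _, _, Or.inl (Or.inr ⟨i, rfl⟩), fun u => (one_smul _ _).symm⟩
    · exact ⟨_, hdet, _, Or.inl (Or.inl ⟨i, rfl⟩), fun u => tracelessPart_tracelessPart p u _⟩
    · exact ⟨1, one_mem _, _, Or.inr (Or.inr ⟨j, rfl⟩), fun u => (one_smul _ _).symm⟩
    · exact ⟨_, hdet, _, Or.inr (Or.inl ⟨j, rfl⟩), fun u => tracelessPart_tracelessPart p u _⟩

end

/-! ### Weights under scaling -/

section scaling
variable {U I J : Type*} {x : U → Matrix I (Fin 2) ℂ} {y : U → Matrix (Fin 2) J ℂ}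
  {p : U → Matrix (Fin 2) (Fin 2) ℂ} {t : ℂ} {u u' : U}

theorem IsTransform.conj_eq_of_smul_one (h : IsTransform x y p (t • 1) u u') (ht : t ≠ 0) :
    p u' = p u := by
  have := h.conj
  simp only [Matrix.mul_smul, Matrix.smul_mul, mul_one, one_mul] at this
  exact smul_right_injective _ ht this

theorem IsTransform.traceAlgebra_eq (h : IsTransform x y p (t • 1) u u') (ht : t ≠ 0)
    {f : U → ℂ} (hf : f ∈ traceAlgebra x y p) : f u' = f u := by
  have hp := h.conj_eq_of_smul_one ht
  unfold traceAlgebra at hf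
  induction hf using Algebra.adjoin_induction with
  | mem f hf =>
    rcases hf with (⟨ij, rfl⟩ | ⟨ij, rfl⟩) | rfl | rfl
    · simp only [← h.left, h.right, Matrix.mul_assoc]
    · simp only [← h.left, h.right, hp, Matrix.mul_assoc]
      simp
    · simp only [hp]
    · simp only [hp]
  | algebraMap k => rfl
  | add f g _ _ hf hg => simp [hf, hg]
  | mul f g _ _ hf hg => simp [hf, hg]

theorem IsTransform.smul_leftVecs (h : IsTransform x y p (t • 1) u u') (ht : t ≠ 0)
    {v : U → Fin 2 → ℂ} (hv : v ∈ leftVecs x p) : t • v u' = v u := by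
  have hp := h.conj_eq_of_smul_one ht
  have hx : ∀ i, t • leftVec x i u' = leftVec x i u := by
    intro i
    funext k
    fin_cases k <;> simp [leftVec, ← h.left]
  rcases hv with ⟨i, rfl⟩ | ⟨i, rfl⟩
  · exact hx i
  · simp only [← hx i]
    funext k
    fin_cases k <;> simp [tracelessPart, traceless, hp] <;> ring

theorem IsTransform.rightVecs_eq (h : IsTransform x y p (t • 1) u u') (ht : t ≠ 0)
    {v : U → Fin 2 → ℂ} (hv : v ∈ rightVecs y p) : v u' = t • v u := by
  have hp := h.conj_eq_of_smul_one ht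
  have hy : ∀ j, rightVec y j u' = t • rightVec y j u := by
    intro j
    funext k
    simp [rightVec, h.right]
  rcases hv with ⟨j, rfl⟩ | ⟨j, rfl⟩
  · exact hy j
  · simp only [hy j]
    funext k
    fin_cases k <;> simp [tracelessPart, traceless, hp] <;> ring

theorem IsTransform.pow_mul_prod_left (h : IsTransform x y p (t • 1) u u') (ht : t ≠ 0)
    (l : List (U → ℂ)) (hl : ∀ f ∈ l, f ∈ sympProducts (leftVecs x p)) :
    t ^ (2 * l.length) * l.prod u' = l.prod u := by
  induction l with
  | nil => simp
  | cons f l ih =>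
    have ih := ih fun g hg => hl g (List.mem_cons_of_mem _ hg)
    obtain ⟨v, hv, w, hw, rfl⟩ := hl f List.mem_cons_self
    simp only [List.prod_cons, Pi.mul_apply, List.length_cons, ← ih, ← h.smul_leftVecs ht hv,
      ← h.smul_leftVecs ht hw]
    simp [symp]
    ring

theorem IsTransform.prod_right_eq (h : IsTransform x y p (t • 1) u u') (ht : t ≠ 0)
    (l : List (U → ℂ)) (hl : ∀ f ∈ l, f ∈ sympProducts (rightVecs y p)) :
    l.prod u' = t ^ (2 * l.length) * l.prod u := by
  induction l with
  | nil => simp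
  | cons f l ih =>
    have ih := ih fun g hg => hl g (List.mem_cons_of_mem _ hg)
    obtain ⟨v, hv, w, hw, rfl⟩ := hl f List.mem_cons_self
    simp only [List.prod_cons, Pi.mul_apply, List.length_cons, ih, h.rightVecs_eq ht hv,
      h.rightVecs_eq ht hw]
    simp [symp]
    ring

theorem prod_mul_prod_mem_traceAlgebra (l m : List (U → ℂ)) (hlm : l.length = m.length)
    (hl : ∀ f ∈ l, f ∈ sympProducts (leftVecs x p))
    (hm : ∀ f ∈ m, f ∈ sympProducts (rightVecs y p)) :
    l.prod * m.prod ∈ traceAlgebra x y p := by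
  induction l generalizing m with
  | nil =>
    obtain rfl : m = [] := by simpa using hlm.symm
    simp
  | cons f l ih =>
    obtain _ | ⟨g, m⟩ := m
    · simp at hlm
    · rw [List.prod_cons, List.prod_cons, mul_mul_mul_comm]
      exact mul_mem
        (sympProducts_mul_mem x y p (hl f List.mem_cons_self) (hm g List.mem_cons_self))
        (ih m (by simpa using hlm) (fun f hf => hl f (List.mem_cons_of_mem _ hf))
          fun f hf => hm f (List.mem_cons_of_mem _ hf))

/-- A monomial in the generators of `symplecticAlgebra`, sorted by weight. -/
theorem exists_eq_mul_prod_mul_prod {f : U → ℂ}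
    (hf : f ∈ Submonoid.closure ((traceAlgebra x y p : Set (U → ℂ)) ∪
      sympProducts (leftVecs x p) ∪ sympProducts (rightVecs y p))) :
    ∃ r ∈ traceAlgebra x y p, ∃ l m : List (U → ℂ),
      (∀ g ∈ l, g ∈ sympProducts (leftVecs x p)) ∧
      (∀ g ∈ m, g ∈ sympProducts (rightVecs y p)) ∧ f = r * (l.prod * m.prod) := by
  induction hf using Submonoid.closure_induction with
  | mem f hf =>
    rcases hf with (hf | hf) | hf
    · exact ⟨f, hf, [], [], by simp, by simp, by simp⟩
    · exact ⟨1, one_mem _, [f], [], by simpa using hf, by simp, by simp⟩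
    · exact ⟨1, one_mem _, [], [f], by simp, by simpa using hf, by simp⟩
  | one => exact ⟨1, one_mem _, [], [], by simp, by simp, by simp⟩
  | mul f g _ _ hf hg =>
    obtain ⟨r, hr, l, m, hl, hm, rfl⟩ := hf
    obtain ⟨r', hr', l', m', hl', hm', rfl⟩ := hg
    refine ⟨r * r', mul_mem hr hr', l ++ l', m ++ m', ?_, ?_, ?_⟩
    · intro g hg
      exact (List.mem_append.1 hg).elim (hl g) (hl' g)
    · intro g hg
      exact (List.mem_append.1 hg).elim (hm g) (hm' g)
    · rw [List.prod_append, List.prod_append]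
      ring

/-- Along a scaling orbit, an element of `symplecticAlgebra` is a Laurent polynomial in the scaling
parameter `t`, here `P u` divided by `t ^ N`, whose constant term lies in `traceAlgebra`. -/
theorem exists_polynomial_along_scaling {f : U → ℂ} (hf : f ∈ symplecticAlgebra x y p) :
    ∃ (N : ℕ) (P : U → Polynomial ℂ), (fun u => (P u).coeff N) ∈ traceAlgebra x y p ∧
      ∀ t : ℂ, t ≠ 0 → ∀ u u', IsTransform x y p (t • 1) u u' →
        t ^ N * f u' = (P u).eval t := by
  unfold symplecticAlgebra at hf
  rw [← Subalgebra.mem_toSubmodule, Algebra.adjoin_eq_span] at hf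
  induction hf using Submodule.span_induction with
  | mem f hf =>
    obtain ⟨r, hr, l, m, hl, hm, rfl⟩ := exists_eq_mul_prod_mul_prod hf
    refine ⟨2 * l.length,
      fun u => Polynomial.monomial (2 * m.length) (r u * (l.prod u * m.prod u)), ?_, ?_⟩
    · simp only [Polynomial.coeff_monomial]
      by_cases hlm : l.length = m.length
      · simp only [hlm, if_true]
        exact mul_mem hr (prod_mul_prod_mem_traceAlgebra l m hlm hl hm)
      · have : ¬ 2 * m.length = 2 * l.length := by omega
        simp only [this, if_false]
        exact zero_mem _
    · intro t ht u u' h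
      simp only [Pi.mul_apply, Polynomial.eval_monomial, h.traceAlgebra_eq ht hr,
        h.prod_right_eq ht m hm, ← h.pow_mul_prod_left ht l hl]
      ring
  | zero => exact ⟨0, 0, zero_mem (traceAlgebra x y p), by simp⟩
  | add f g _ _ hf hg =>
    obtain ⟨N, P, hP, hf⟩ := hf
    obtain ⟨M, Q, hQ, hg⟩ := hg
    refine ⟨N + M, fun u => P u * Polynomial.X ^ M + Q u * Polynomial.X ^ N, ?_, ?_⟩
    · simp only [Polynomial.coeff_add, Polynomial.coeff_mul_X_pow]
      simp only [add_comm N M, Polynomial.coeff_mul_X_pow]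
      exact add_mem hP hQ
    · intro t ht u u' h
      simp only [Pi.add_apply, Polynomial.eval_add, Polynomial.eval_mul, Polynomial.eval_pow,
        Polynomial.eval_X, ← hf t ht u u' h, ← hg t ht u u' h]
      ring
  | smul k f _ hf =>
    obtain ⟨N, P, hP, hf⟩ := hf
    refine ⟨N, fun u => k • P u, ?_, ?_⟩
    · simp only [Polynomial.coeff_smul]
      exact Subalgebra.smul_mem _ hP k
    · intro t ht u u' h
      simp only [Pi.smul_apply, Polynomial.eval_smul, ← hf t ht u u' h, smul_eq_mul]
      ring

/-- A scaling-invariant element of `symplecticAlgebra` equals its weight-zero part. -/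
theorem mem_traceAlgebra_of_scaling_invariant {f : U → ℂ} (hf : f ∈ symplecticAlgebra x y p)
    (hinv : ∀ t : ℂ, t ≠ 0 → ∀ u, ∃ u', IsTransform x y p (t • 1) u u' ∧ f u' = f u) :
    f ∈ traceAlgebra x y p := by
  obtain ⟨N, P, hP, h⟩ := exists_polynomial_along_scaling hf
  convert hP using 1
  funext u
  have hPu : P u = Polynomial.monomial N (f u) := by
    refine Polynomial.eq_of_infinite_eval_eq _ _
      ((Set.finite_singleton (0 : ℂ)).infinite_compl.mono fun t ht => ?_)
    obtain ⟨u', hu', e⟩ := hinv t ht u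
    rw [Set.mem_ofPred_eq, ← h t ht u u' hu', e, Polynomial.eval_monomial, mul_comm]
  rw [hPu, Polynomial.coeff_monomial, if_pos rfl]

end scaling

/-! ### The first fundamental theorem -/

section firstFundamentalTheorem
open MvPolynomial
variable {U I J : Type*} {x : U → Matrix I (Fin 2) ℂ} {y : U → Matrix (Fin 2) J ℂ}
  {p : U → Matrix (Fin 2) (Fin 2) ℂ}

/-- The point of the space of generic matrices given by a matrix. -/
def genericPoint (M : Matrix (Fin 2) (Fin 2) ℂ) : Fin 4 → ℂ := ![M 0 0, M 0 1, M 1 0, M 1 1]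

theorem eval_delta (M : Matrix (Fin 2) (Fin 2) ℂ) :
    eval (genericPoint M) delta = M.det := by
  simp [genericPoint, delta, Matrix.det_fin_two]

variable (x y p) in
/-- The covariants built from the triple `(x, y, p)`. -/
noncomputable abbrev tripleCovariants : Subalgebra ℂ (U → MvPolynomial (Fin 4) ℂ) :=
  covariantAlgebra (symplecticAlgebra x y p) (leftVecs x p ∪ rightVecs y p)
    (fun u => (p u 0 0 - p u 1 1) / 2) (fun u => p u 0 1) (fun u => p u 1 0)

theorem IsTransform.det_smul_left {M : Matrix (Fin 2) (Fin 2) ℂ} {u u' : U}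
    (h : IsTransform x y p M u u') : M.det • x u' = x u * M.adjugate := by
  rw [← h.left, Matrix.mul_assoc, Matrix.mul_adjugate, Matrix.mul_smul, Matrix.mul_one]

theorem IsTransform.det_smul_conj {M : Matrix (Fin 2) (Fin 2) ℂ} {u u' : U}
    (h : IsTransform x y p M u u') : M.det • p u' = M * p u * M.adjugate := by
  rw [← h.conj, Matrix.mul_assoc, Matrix.mul_adjugate, Matrix.mul_smul, Matrix.mul_one]

/-- Up to a power of the determinant, the value of a polynomial function at the transform by `M` is
the value at `M` of a covariant. -/
theorem exists_covariant {f : U → ℂ} (hf : f ∈ entryAlgebra x y p) :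
    ∃ n : ℕ, ∃ E ∈ tripleCovariants x y p, ∀ M u u', IsTransform x y p M u u' →
      eval (genericPoint M) (E u) = f u' * M.det ^ n := by
  unfold entryAlgebra at hf
  induction hf using Algebra.adjoin_induction with
  | mem f hf =>
    rcases hf with (⟨⟨i, k⟩, rfl⟩ | ⟨⟨k, j⟩, rfl⟩) | ⟨⟨k, l⟩, rfl⟩
    · have hi : leftVec x i ∈ leftVecs x p ∪ rightVecs y p := Or.inl (Or.inl ⟨i, rfl⟩)
      have key : ∀ M u u', IsTransform x y p M u u' →
          x u' i k * M.det ^ 1 = (x u * M.adjugate) i k := by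
        intro M u u' h
        rw [← h.det_smul_left, Matrix.smul_apply, smul_eq_mul, pow_one, mul_comm]
      fin_cases k
      · refine ⟨1, _, (IsCovariantGenerator.row₁ _ hi).mem, fun M u u' h => ?_⟩
        rw [key M u u' h]
        simp [row₁, genericPoint, leftVec, Matrix.adjugate_fin_two, Matrix.mul_apply]
        ring
      · refine ⟨1, _, neg_mem (IsCovariantGenerator.row₀ _ hi).mem, fun M u u' h => ?_⟩
        rw [key M u u' h]
        simp [row₀, genericPoint, leftVec, Matrix.adjugate_fin_two, Matrix.mul_apply]
    · have hj : rightVec y j ∈ leftVecs x p ∪ rightVecs y p := Or.inr (Or.inl ⟨j, rfl⟩)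
      fin_cases k
      · refine ⟨0, _, (IsCovariantGenerator.row₀ _ hj).mem, fun M u u' h => ?_⟩
        simp [row₀, genericPoint, rightVec, Matrix.mul_apply, h.right]
        ring
      · refine ⟨0, _, (IsCovariantGenerator.row₁ _ hj).mem, fun M u u' h => ?_⟩
        simp [row₁, genericPoint, rightVec, Matrix.mul_apply, h.right]
        ring
    · have key : ∀ M u u', IsTransform x y p M u u' →
          p u' k l * M.det ^ 1 = (M * p u * M.adjugate) k l := by
        intro M u u' h
        rw [← h.det_smul_conj, Matrix.smul_apply, smul_eq_mul, pow_one, mul_comm]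
      -- The scalar part `tr p / 2` of `p` contributes to the diagonal entries.
      have htr : (fun u => C ((1 / 2 : ℂ) • (p u).trace) * delta) ∈ tripleCovariants x y p :=
        mul_mem (IsCovariantGenerator.const _ (Subalgebra.smul_mem _
          (traceAlgebra_le_symplecticAlgebra x y p (trace_mem_traceAlgebra x y p)) _)).mem
          IsCovariantGenerator.delta.mem
      fin_cases k <;> fin_cases l
      · refine ⟨1, _, add_mem IsCovariantGenerator.conj₀₀.mem htr, fun M u u' h => ?_⟩
        rw [key M u u' h]
        simp [conj₀₀, delta, genericPoint, Matrix.adjugate_fin_two, Matrix.mul_apply,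
          Matrix.trace_fin_two]
        ring
      · refine ⟨1, _, IsCovariantGenerator.conj₀₁.mem, fun M u u' h => ?_⟩
        rw [key M u u' h]
        simp [conj₀₁, genericPoint, Matrix.adjugate_fin_two, Matrix.mul_apply]
        ring
      · refine ⟨1, _, IsCovariantGenerator.conj₁₀.mem, fun M u u' h => ?_⟩
        rw [key M u u' h]
        simp [conj₁₀, genericPoint, Matrix.adjugate_fin_two, Matrix.mul_apply]
        ring
      · refine ⟨1, _, sub_mem htr IsCovariantGenerator.conj₀₀.mem, fun M u u' h => ?_⟩
        rw [key M u u' h]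
        simp [conj₀₀, delta, genericPoint, Matrix.adjugate_fin_two, Matrix.mul_apply,
          Matrix.trace_fin_two]
        ring
  | algebraMap k =>
    exact ⟨0, _, Subalgebra.algebraMap_mem _ k, fun M u u' h => by simp [algebraMap_eq]⟩
  | add f g _ _ hf hg =>
    obtain ⟨n, E, hE, hf⟩ := hf
    obtain ⟨m, F, hF, hg⟩ := hg
    have hδ : (fun _ => delta) ∈ tripleCovariants x y p := IsCovariantGenerator.delta.mem
    refine ⟨n + m, _, add_mem (mul_mem hE (pow_mem hδ m)) (mul_mem hF (pow_mem hδ n)),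
      fun M u u' h => ?_⟩
    simp only [Pi.add_apply, Pi.mul_apply, Pi.pow_apply, map_add, map_mul, map_pow, eval_delta,
      hf M u u' h, hg M u u' h]
    ring
  | mul f g _ _ hf hg =>
    obtain ⟨n, E, hE, hf⟩ := hf
    obtain ⟨m, F, hF, hg⟩ := hg
    refine ⟨n + m, _, mul_mem hE hF, fun M u u' h => ?_⟩
    simp only [Pi.mul_apply, map_mul, hf M u u' h, hg M u u' h]
    ring

theorem delta_ne_zero : delta ≠ 0 := by
  intro h
  simpa [h] using eval_delta 1

/-- Polynomials in a generic matrix that agree on invertible matrices are equal. -/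
theorem eq_of_eval_eq_of_det_ne_zero {E F : MvPolynomial (Fin 4) ℂ}
    (h : ∀ M : Matrix (Fin 2) (Fin 2) ℂ, M.det ≠ 0 →
      eval (genericPoint M) E = eval (genericPoint M) F) : E = F := by
  refine mul_right_cancel₀ delta_ne_zero (funext fun z => ?_)
  have hz : genericPoint !![z 0, z 1; z 2, z 3] = z := by
    funext k
    fin_cases k <;> rfl
  rw [← hz, map_mul, map_mul, eval_delta]
  by_cases hdet : (!![z 0, z 1; z 2, z 3] : Matrix (Fin 2) (Fin 2) ℂ).det = 0
  · rw [hdet, mul_zero, mul_zero]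
  · rw [h _ hdet]

/-- The first fundamental theorem for `GL₂` acting on rows, columns and one matrix. -/
theorem mem_traceAlgebra_of_invariant {f : U → ℂ} (hf : f ∈ entryAlgebra x y p)
    (hinv : ∀ M : Matrix (Fin 2) (Fin 2) ℂ, M.det ≠ 0 →
      ∀ u, ∃ u', IsTransform x y p M u u' ∧ f u' = f u) : f ∈ traceAlgebra x y p := by
  obtain ⟨n, E, hE, h⟩ := exists_covariant hf
  have hEf : E = fun u => C (f u) * delta ^ n := by
    funext u
    refine eq_of_eval_eq_of_det_ne_zero fun M hM => ?_
    obtain ⟨u', hu', e⟩ := hinv M hM u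
    rw [h M u u' hu', e, map_mul, map_pow, eval_delta, eval_C]
  refine mem_traceAlgebra_of_scaling_invariant
    ((isOmegaStable_symplecticAlgebra x y p).mem_of_delta_pow_mul_mem n (hEf ▸ hE))
    fun t ht => hinv _ ?_
  simpa [Matrix.det_smul] using ht

end firstFundamentalTheorem
end MatrixTriple

/-! ### Passage to vector spaces and schemes -/

section coordinates
variable {S V : Type u} [AddCommGroup S] [Module ℂ S] [AddCommGroup V] [Module ℂ V]

open MatrixTriple LinearMap

/-- A linear functional on a space of linear maps is a combination of matrix entries. -/
theorem dual_hom_mem_adjoin_entries {U A B : Type*} [AddCommGroup A] [Module ℂ A] [AddCommGroup B]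
    [Module ℂ B] {ι κ : Type*} [Fintype ι] [Fintype κ] [DecidableEq ι] [DecidableEq κ]
    (a : Module.Basis ι ℂ A) (b : Module.Basis κ ℂ B) (φ : Module.Dual ℂ (A →ₗ[ℂ] B))
    (F : U → A →ₗ[ℂ] B) (D : Subalgebra ℂ (U → ℂ))
    (hD : ∀ k i, (fun u => toMatrix a b (F u) k i) ∈ D) : (fun u => φ (F u)) ∈ D := by
  have key : (fun u => φ (F u)) = ∑ k, ∑ i,
      φ ((toMatrix a b).symm (Matrix.single k i 1)) • fun u => toMatrix a b (F u) k i := by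
    funext u
    conv_lhs => rw [← (toMatrix a b).symm_apply_apply (F u),
      Matrix.matrix_eq_sum_single (toMatrix a b (F u))]
    simp only [map_sum, Finset.sum_apply, Pi.smul_apply, smul_eq_mul]
    refine Finset.sum_congr rfl fun k _ => Finset.sum_congr rfl fun i _ => ?_
    rw [show Matrix.single k i (toMatrix a b (F u) k i) =
      toMatrix a b (F u) k i • Matrix.single k i 1 by simp, map_smul, map_smul, smul_eq_mul,
      mul_comm]
  rw [key]
  exact sum_mem fun k _ => sum_mem fun i _ => Subalgebra.smul_mem _ (hD k i) _

theorem polyFun_le_entryAlgebra {ι : Type*} [Fintype ι] [DecidableEq ι]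
    (s : Module.Basis (Fin 2) ℂ S) (b : Module.Basis ι ℂ V) :
    polyFun (HomHomEnd S V) ≤ entryAlgebra (fun z : HomHomEnd S V => toMatrix s b z.1)
      (fun z => toMatrix b s z.2.1) (fun z => toMatrix s s z.2.2) := by
  refine Algebra.adjoin_le ?_
  rintro _ ⟨φ, rfl⟩
  have hφ : (φ : HomHomEnd S V → ℂ) =
      (fun z => (φ ∘ₗ inl ℂ _ _) z.1) +
      ((fun z => (φ ∘ₗ inr ℂ _ _ ∘ₗ inl ℂ _ _) z.2.1) +
        fun z => (φ ∘ₗ inr ℂ _ _ ∘ₗ inr ℂ _ _) z.2.2) := by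
    funext z
    simp only [Pi.add_apply, LinearMap.comp_apply, ← map_add, inl_apply, inr_apply]
    simp
  change (φ : HomHomEnd S V → ℂ) ∈ _
  rw [hφ]
  refine add_mem ?_ (add_mem ?_ ?_)
  · exact dual_hom_mem_adjoin_entries s b _ _ _
      fun k i => Algebra.subset_adjoin (Or.inl (Or.inl ⟨(k, i), rfl⟩))
  · exact dual_hom_mem_adjoin_entries b s _ _ _
      fun k i => Algebra.subset_adjoin (Or.inl (Or.inr ⟨(k, i), rfl⟩))
  · exact dual_hom_mem_adjoin_entries s s _ _ _
      fun k i => Algebra.subset_adjoin (Or.inr ⟨(k, i), rfl⟩)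

theorem invariantMap_glRep (g : LinearMap.GeneralLinearGroup ℂ S) (z : HomHomEnd S V) :
    invariantMap S V (glRep S V g z) = invariantMap S V z := by
  have hg : ∀ s, (g⁻¹).val (g.val s) = s := fun s => by
    rw [← Module.End.mul_apply, ← Units.val_mul]; simp
  simp only [invariantMap, glRep, MonoidHom.coe_mk, OneHom.coe_mk, LinearMap.coe_mk,
    AddHom.coe_mk]
  refine Prod.ext ?_ (Prod.ext ?_ (Prod.ext ?_ ?_))
  · ext v
    simp [hg]
  · ext v
    simp [hg]
  · change LinearMap.det (g.val * (z.2.2 * (g⁻¹).val)) = _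
    rw [map_mul, map_mul, mul_left_comm, ← map_mul, ← Units.val_mul]
    simp
  · change LinearMap.trace ℂ S (g.val * (z.2.2 * (g⁻¹).val)) = _
    rw [← mul_assoc, LinearMap.trace_conj]

theorem invariantRing_le_traceAlgebra {ι : Type*} [Fintype ι] [DecidableEq ι]
    (s : Module.Basis (Fin 2) ℂ S) (b : Module.Basis ι ℂ V) :
    invariantRing (glRep S V) ≤ traceAlgebra (fun z : HomHomEnd S V => toMatrix s b z.1)
      (fun z => toMatrix b s z.2.1) (fun z => toMatrix s s z.2.2) := by
  rintro f ⟨hf, hinv⟩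
  refine mem_traceAlgebra_of_invariant (polyFun_le_entryAlgebra s b hf) fun M hM z => ?_
  have hM' : IsUnit M.det := isUnit_iff_ne_zero.2 hM
  let g : LinearMap.GeneralLinearGroup ℂ S :=
    ⟨Matrix.toLin s s M, Matrix.toLin s s M⁻¹,
      by rw [Module.End.mul_eq_comp, ← Matrix.toLin_mul, Matrix.mul_nonsing_inv _ hM',
        Matrix.toLin_one, Module.End.one_eq_id],
      by rw [Module.End.mul_eq_comp, ← Matrix.toLin_mul, Matrix.nonsing_inv_mul _ hM',
        Matrix.toLin_one, Module.End.one_eq_id]⟩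
  have hg : toMatrix s s g.val = M := toMatrix_toLin s s M
  have hg' : toMatrix s s (g⁻¹).val = M⁻¹ := toMatrix_toLin s s M⁻¹
  refine ⟨glRep S V g z, ⟨?_, ?_, ?_⟩, hinv g z⟩
  · change toMatrix s b (z.1 ∘ₗ (g⁻¹).val) * M = _
    rw [toMatrix_comp s s b, hg', Matrix.mul_assoc, Matrix.nonsing_inv_mul _ hM', Matrix.mul_one]
  · change toMatrix b s (g.val ∘ₗ z.2.1) = _
    rw [toMatrix_comp b s s, hg]
  · change toMatrix s s (g.val ∘ₗ z.2.2 ∘ₗ (g⁻¹).val) * M = _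
    rw [toMatrix_comp s s s, toMatrix_comp s s s, hg, hg', Matrix.mul_assoc, Matrix.mul_assoc,
      Matrix.nonsing_inv_mul _ hM', Matrix.mul_one]

/-- Each of the claimed generators is a linear functional of `invariantMap`. -/
theorem exists_dual_comp_invariantMap {n : ℕ} (b : Module.Basis (Fin n) ℂ V)
    {f : HomHomEnd S V → ℂ}
    (hf : f ∈ ((Set.range fun ij : Fin n × Fin n => fun z : HomHomEnd S V =>
          LinearMap.toMatrix b b (z.1 ∘ₗ z.2.1) ij.1 ij.2) ∪
        (Set.range fun ij : Fin n × Fin n => fun z : HomHomEnd S V =>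
          LinearMap.toMatrix b b (z.1 ∘ₗ z.2.2 ∘ₗ z.2.1) ij.1 ij.2) ∪
        {fun z : HomHomEnd S V => LinearMap.det z.2.2,
          fun z : HomHomEnd S V => LinearMap.trace ℂ S z.2.2})) :
    ∃ φ : Module.Dual ℂ ((V →ₗ[ℂ] V) × (V →ₗ[ℂ] V) × ℂ × ℂ),
      f = fun z => φ (invariantMap S V z) := by
  rcases hf with (⟨ij, rfl⟩ | ⟨ij, rfl⟩) | rfl | rfl
  · exact ⟨Matrix.entryLinearMap ℂ ℂ ij.1 ij.2 ∘ₗ (toMatrix b b).toLinearMap ∘ₗ fst ℂ _ _, rfl⟩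
  · exact ⟨Matrix.entryLinearMap ℂ ℂ ij.1 ij.2 ∘ₗ (toMatrix b b).toLinearMap ∘ₗ
      fst ℂ _ _ ∘ₗ snd ℂ _ _, rfl⟩
  · exact ⟨fst ℂ _ _ ∘ₗ snd ℂ _ _ ∘ₗ snd ℂ _ _, rfl⟩
  · exact ⟨snd ℂ _ _ ∘ₗ snd ℂ _ _ ∘ₗ snd ℂ _ _, rfl⟩

variable [FiniteDimensional ℂ S] [FiniteDimensional ℂ V]

theorem comp_invariantMap_mem_invariantRing
    {f : (V →ₗ[ℂ] V) × (V →ₗ[ℂ] V) × ℂ × ℂ → ℂ} (hf : f ∈ polyFun _) :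
    (fun z => f (invariantMap S V z)) ∈ invariantRing (glRep S V) :=
  ⟨(isPolyMap_invariantMap S V).comp_mem hf, fun g z => congrArg f (invariantMap_glRep g z)⟩

theorem invariantRing_eq_adjoin (hS : Module.finrank ℂ S = 2) (n : ℕ)
    (b : Module.Basis (Fin n) ℂ V) :
    invariantRing (glRep S V) =
      Algebra.adjoin ℂ
        ((Set.range fun ij : Fin n × Fin n => fun z : HomHomEnd S V =>
            LinearMap.toMatrix b b (z.1 ∘ₗ z.2.1) ij.1 ij.2) ∪
          (Set.range fun ij : Fin n × Fin n => fun z : HomHomEnd S V =>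
            LinearMap.toMatrix b b (z.1 ∘ₗ z.2.2 ∘ₗ z.2.1) ij.1 ij.2) ∪
          {fun z : HomHomEnd S V => LinearMap.det z.2.2,
            fun z : HomHomEnd S V => LinearMap.trace ℂ S z.2.2}) := by
  apply le_antisymm
  · let s : Module.Basis (Fin 2) ℂ S := Module.finBasisOfFinrankEq ℂ S hS
    refine (invariantRing_le_traceAlgebra s b).trans (le_of_eq ?_)
    simp only [traceAlgebra, toMatrix_comp b s b, toMatrix_comp b s s, ← det_toMatrix s,
      LinearMap.trace_eq_matrix_trace ℂ s, Matrix.mul_assoc]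
  · refine Algebra.adjoin_le fun f hf => ?_
    obtain ⟨φ, rfl⟩ := exists_dual_comp_invariantMap b hf
    exact comp_invariantMap_mem_invariantRing (linear_mem_polyFun φ)

variable (S V) in
/-- The pull-back of polynomial functions along `invariantMap`, with values in the invariants. -/
noncomputable def invariantPullback :
    polyFun ((V →ₗ[ℂ] V) × (V →ₗ[ℂ] V) × ℂ × ℂ) →ₐ[ℂ] invariantRing (glRep S V) :=
  ((polyFun (HomHomEnd S V)).val.comp (isPolyMap_invariantMap S V).pullback).codRestrict _
    fun f => comp_invariantMap_mem_invariantRing f.2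

/-- The image of the pull-back contains the generators of the ring of invariants. -/
theorem invariantPullback_surjective (hS : Module.finrank ℂ S = 2) :
    Function.Surjective (invariantPullback S V) := by
  let b := Module.finBasis ℂ V
  have hle : invariantRing (glRep S V) ≤
      ((invariantRing (glRep S V)).val.comp (invariantPullback S V)).range := by
    refine (invariantRing_eq_adjoin hS _ b).trans_le (Algebra.adjoin_le fun f hf => ?_)
    obtain ⟨φ, rfl⟩ := exists_dual_comp_invariantMap b hf
    exact ⟨⟨_, linear_mem_polyFun φ⟩, rfl⟩
  rintro ⟨f, hf⟩
  obtain ⟨h, e⟩ := hle hf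
  exact ⟨h, Subtype.ext e⟩

end coordinates

theorem lemma4p1 {S V : Type u} [AddCommGroup S] [Module ℂ S] [FiniteDimensional ℂ S]
    [AddCommGroup V] [Module ℂ V] [FiniteDimensional ℂ V] (hS : Module.finrank ℂ S = 2) :
    (∃ ι : affineQuotient (glRep S V) ⟶ affineSpaceOf ((V →ₗ[ℂ] V) × (V →ₗ[ℂ] V) × ℂ × ℂ),
      quotientHom (glRep S V) ≫ ι = (isPolyMap_invariantMap S V).toHom ∧
        IsClosedImmersion ι) ∧
    ∀ (n : ℕ) (b : Module.Basis (Fin n) ℂ V),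
      invariantRing (glRep S V) =
        Algebra.adjoin ℂ
          ((Set.range fun ij : Fin n × Fin n => fun z : HomHomEnd S V =>
              LinearMap.toMatrix b b (z.1 ∘ₗ z.2.1) ij.1 ij.2) ∪
            (Set.range fun ij : Fin n × Fin n => fun z : HomHomEnd S V =>
              LinearMap.toMatrix b b (z.1 ∘ₗ z.2.2 ∘ₗ z.2.1) ij.1 ij.2) ∪
            {fun z : HomHomEnd S V => LinearMap.det z.2.2,
              fun z : HomHomEnd S V => LinearMap.trace ℂ S z.2.2}) := by
  refine ⟨⟨Spec.map (CommRingCat.ofHom (invariantPullback S V).toRingHom), ?_, ?_⟩,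
    fun n b => invariantRing_eq_adjoin hS n b⟩
  · exact (Spec.map_comp _ _).symm
  · exact IsClosedImmersion.spec_of_surjective _ (invariantPullback_surjective hS)
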